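/- Let $\Omega$ be a compact Hausdorff space with a finite Borel measure $\mu$ of full support (every non-empty open set has positive measure), and let $K:\Omega\times\Omega\to\mathbb{R}$ be a continuous symmetric positive definite kernel, i.e. $\sum_{j,k}c_jc_kK(x_j,x_k)\ge 0$ for all finitely many pairwise distinct points $x_j\in\Omega$ and all real $c_j$. Let $(\lambda_n)_{n\in I}$, $(e_n)_{n\in I}$ ($I$ countable, finite or infinite) be the positive eigenvalues and the eigenfunctions of $K$, counted with multiplicity: $\lambda_n>0$, the $e_n$ are continuous and orthonormal in $L_2(\mu)$, $\int_\Omega K(x,y)e_n(y)\,\mu(dy)=\lambda_ne_n(x)$ for all $x\in\Omega$, and no nonzero continuous eigenfunction with a positive eigenvalue is orthogonal to all $e_n$. Assume $$\sum_{n}\lambda_n^{1/2}|e_n(x)|<\infty\quad\text{for all }x\in\Omega .$$ For $1\le p\le\infty$ put $\ell_p^0=\ell_p(I)$ if $p<\infty$ and $\ell^0_\infty=c_0(I)$, and let $$\mathcal{B}_K^p(\Omega)=\Big\{f=\sum_{n}a_n\lambda_n^{1/2}e_n:\ (a_n)\in\ell_p^0\Big\},\qquad \|f\|_{\mathcal{B}_K^p(\Omega)}=\|(a_n)\|_p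 ,$$ with pointwise summation. If $\mathcal{B}$ is a Banach space of measurable functions on $\Omega$ whose dual $\mathcal{B}'$ is identified by an isometric isomorphism with a normed space $\mathcal{F}$ of measurable functions on $\Omega$, then $\mathcal{B}$ is called a right-sided reproducing kernel Banach space (RKBS) with right-sided reproducing kernel $K$ if $K$ is measurable and, for all $x\in\Omega$ and $f\in\mathcal{B}$, $K(x,\cdot)\in\mathcal{F}$ and $\langle f,K(x,\cdot)\rangle_{\mathcal{B}}=f(x)$. It is called a two-sided RKBS with two-sided reproducing kernel $K$ if moreover, under the same identification, for all $y\in\Omega$ and $g\in\mathcal{F}$, $K(\cdot,y)\in\mathcal{B}$ and $\langle K(\cdot,y),g\rangle_{\mathcal{B}}=g(y)$. Then the spaces $\mathcal{B}_K^p(\Omega)$ and their norms are well-defined (the coefficients $(a_n)$ of $f$ are unique), and: (1) $\mathcal{B}^1_K(\Omega)$ is a right-sided RKBS with right-sided reproducing kernel $K$, for a function space $\mathcal{F}\cong(\mathcal{B}^1_K(\Omega))'$ that contains $\mathcal{B}^\infty_K(\Omega)$ isometrically; (2) for every $1<p\le\infty$, $\mathcal{B}^p_K(\Omega)$ is a two-sided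 RKBS with two-sided reproducing kernel $K$, with $\mathcal{F}=\mathcal{B}^q_K(\Omega)\cong(\mathcal{B}^p_K(\Omega))'$, where $1/p+1/q=1$. -/

import Mathlib

open MeasureTheory Filter Topology
open scoped ENNReal

noncomputable section

/-! ### Normed spaces of measurable functions -/

/-- A real normed space whose elements are measurable functions `Ω → ℝ`, with the pointwise
linear structure. -/
structure NormedFunctionSpace (Ω : Type*) [MeasurableSpace Ω] where
  toSubmodule : Submodule ℝ (Ω → ℝ)
  measurable' : ∀ f ∈ toSubmodule, Measurable f
  norm' : toSubmodule → ℝ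
  norm_nonneg' : ∀ f, 0 ≤ norm' f
  norm_smul' : ∀ (c : ℝ) (f), norm' (c • f) = |c| * norm' f
  norm_add_le' : ∀ f g, norm' (f + g) ≤ norm' f + norm' g
  norm_eq_zero' : ∀ f, norm' f = 0 → f = 0

namespace NormedFunctionSpace

variable {Ω : Type*} [MeasurableSpace Ω]

/-- The type of elements of `B`. It is not reducible, so that its topology is the
one of the norm of `B` and not the topology of pointwise convergence. -/
def Elem (B : NormedFunctionSpace Ω) : Type _ := B.toSubmodule

instance (B : NormedFunctionSpace Ω) : AddCommGroup B.Elem :=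
  inferInstanceAs (AddCommGroup B.toSubmodule)

instance (B : NormedFunctionSpace Ω) : Module ℝ B.Elem :=
  inferInstanceAs (Module ℝ B.toSubmodule)

instance (B : NormedFunctionSpace Ω) : Norm B.Elem := ⟨B.norm'⟩

theorem core (B : NormedFunctionSpace Ω) : NormedSpace.Core ℝ B.Elem where
  norm_nonneg f := B.norm_nonneg' f
  norm_smul c f := B.norm_smul' c f
  norm_triangle f g := B.norm_add_le' f g
  norm_eq_zero_iff f := by
    refine ⟨B.norm_eq_zero' f, ?_⟩
    rintro rfl
    have h := B.norm_smul' 0 0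
    rw [zero_smul, abs_zero, zero_mul] at h
    exact h

instance (B : NormedFunctionSpace Ω) : NormedAddCommGroup B.Elem :=
  NormedAddCommGroup.ofCore B.core

instance (B : NormedFunctionSpace Ω) : NormedSpace ℝ B.Elem :=
  NormedSpace.ofCore B.core

/-- An element of `B`, as a function on `Ω`. -/
def Elem.fn {B : NormedFunctionSpace Ω} (f : B.Elem) : Ω → ℝ := f.1

/-- The function `f`, as an element of `B`. -/
def elem (B : NormedFunctionSpace Ω) (f : Ω → ℝ) (hf : f ∈ B.toSubmodule) : B.Elem := ⟨f, hf⟩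

/-- `B` is a subspace of `F`, with the same norm. -/
def IsIsometricSubspace (B F : NormedFunctionSpace Ω) : Prop :=
  ∀ f (hf : f ∈ B.toSubmodule), ∃ hf' : f ∈ F.toSubmodule, ‖F.elem f hf'‖ = ‖B.elem f hf‖

end NormedFunctionSpace

/-! ### Reproducing kernel Banach spaces -/

/-- `B` is a right-sided reproducing kernel Banach space with right-sided reproducing kernel `K`:
`B` is a Banach space of functions on `Ω`, its dual is identified by an isometric isomorphism `J`
with the normed space `F` of functions on `Ω'`, and for all `x`, `K(x,·) ∈ F` and
`⟨f, K(x,·)⟩ = f(x)` for all `f ∈ B`. -/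
def IsRightSidedRKBS {Ω Ω' : Type*} [MeasurableSpace Ω] [MeasurableSpace Ω']
    (B : NormedFunctionSpace Ω) (F : NormedFunctionSpace Ω') (K : Ω → Ω' → ℝ) : Prop :=
  CompleteSpace B.Elem ∧ Measurable (Function.uncurry K) ∧
  ∃ J : StrongDual ℝ B.Elem ≃ₗᵢ[ℝ] F.Elem,
    ∀ x, ∃ hx : K x ∈ F.toSubmodule, ∀ f : B.Elem, J.symm (F.elem (K x) hx) f = f.fn x

/-- `B` is a two-sided reproducing kernel Banach space with two-sided reproducing kernel `K`:
under one and the same identification `J` of its dual with a normed function space `F` on `Ω'`,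
`K(x,·) ∈ F` and `⟨f, K(x,·)⟩ = f(x)` for all `x`, `f ∈ B`, and moreover
`K(·,y) ∈ B` and `⟨K(·,y), g⟩ = g(y)` for all `y`, `g ∈ F`. -/
def IsTwoSidedRKBS {Ω Ω' : Type*} [MeasurableSpace Ω] [MeasurableSpace Ω']
    (B : NormedFunctionSpace Ω) (F : NormedFunctionSpace Ω') (K : Ω → Ω' → ℝ) : Prop :=
  CompleteSpace B.Elem ∧ Measurable (Function.uncurry K) ∧
  ∃ J : StrongDual ℝ B.Elem ≃ₗᵢ[ℝ] F.Elem,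
    (∀ x, ∃ hx : K x ∈ F.toSubmodule, ∀ f : B.Elem, J.symm (F.elem (K x) hx) f = f.fn x) ∧
    (∀ y, ∃ hy : (fun x => K x y) ∈ B.toSubmodule,
      ∀ g : F.Elem, J.symm g (B.elem (fun x => K x y) hy) = g.fn y)

/-! ### Positive definite kernels, their eigenvalues and eigenfunctions -/

/-- `K` is positive definite: all its finite quadratic forms at pairwise distinct points are
nonnegative. -/
def IsPositiveDefiniteKernel {Ω : Type*} (K : Ω → Ω → ℝ) : Prop :=
  ∀ (N : ℕ) (x : Fin N → Ω), Function.Injective x → ∀ c : Fin N → ℝ,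
    0 ≤ ∑ j, ∑ k, c j * c k * K (x j) (x k)

/-- `l` and `e` are the positive eigenvalues and the eigenfunctions of the integral operator of `K`
on `L²(μ)`, counted with multiplicity: the `e n` are continuous and orthonormal in `L²(μ)`,
`∫ K(x,y) eₙ(y) dμ(y) = lₙ eₙ(x)` with `lₙ > 0`, and no eigenfunction with a positive eigenvalue
is left out, that is, none but `0` is orthogonal to all `e n`. -/
structure IsEigenSystem {Ω ι : Type*} [TopologicalSpace Ω] [MeasurableSpace Ω] (μ : Measure Ω)
    (K : Ω → Ω → ℝ) (l : ι → ℝ) (e : ι → Ω → ℝ) : Prop where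
  pos : ∀ n, 0 < l n
  continuous : ∀ n, Continuous (e n)
  eigen : ∀ n x, ∫ y, K x y * e n y ∂μ = l n * e n x
  norm_one : ∀ n, ∫ x, e n x * e n x ∂μ = 1
  orthogonal : ∀ m n, m ≠ n → ∫ x, e m x * e n x ∂μ = 0
  exhaustive : ∀ (c : ℝ) (f : Ω → ℝ), 0 < c → Continuous f →
    (∀ x, ∫ y, K x y * f y ∂μ = c * f x) → (∀ n, ∫ x, f x * e n x ∂μ = 0) → f = 0

/-! ### The spaces of series with coefficients in `ℓᵖ` (for `p = ∞`: in `c₀`) -/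

/-- `ℓᵖ` for `p < ∞`, and `c₀` (with the supremum norm) for `p = ∞`. -/
def seqSpace (ι : Type*) (p : ℝ≥0∞) [Fact (1 ≤ p)] : Submodule ℝ (lp (fun _ : ι => ℝ) p) where
  carrier := {a | p = ∞ → Tendsto (fun n => a n) cofinite (𝓝 0)}
  zero_mem' _ := by simpa using tendsto_const_nhds
  add_mem' ha hb h := by simpa using (ha h).add (hb h)
  smul_mem' c a ha h := by simpa using (ha h).const_mul c

/-- The function `∑ₙ aₙ φₙ`, summed pointwise. -/
def seriesFn {Ω ι : Type*} (φ : ι → Ω → ℝ) (a : ι → ℝ) : Ω → ℝ := fun x => ∑' n, a n * φ n x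

/-- The conditions under which the spaces of series `∑ₙ aₙ φₙ` and their norms are well-defined:
the series of a null sequence converges absolutely at each point and determines its
coefficients. -/
structure IsExpansionSet {Ω ι : Type*} [MeasurableSpace Ω] (φ : ι → Ω → ℝ) : Prop where
  measurable : ∀ n, Measurable (φ n)
  summable : ∀ x, Summable fun n => |φ n x|
  unique : ∀ a b : ι → ℝ, Tendsto a cofinite (𝓝 0) → Tendsto b cofinite (𝓝 0) →
    seriesFn φ a = seriesFn φ b → a = b

section SeriesSpace

variable {Ω ι : Type*} [MeasurableSpace Ω] {φ : ι → Ω → ℝ}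

theorem seqSpace_tendsto {p : ℝ≥0∞} [Fact (1 ≤ p)] (a : seqSpace ι p) :
    Tendsto (fun n => a.1 n) cofinite (𝓝 0) := by
  by_cases hp : p = ∞
  · exact a.2 hp
  · have h0 : 0 < p.toReal :=
      ENNReal.toReal_pos (zero_lt_one.trans_le (Fact.out : 1 ≤ p)).ne' hp
    have h := ((lp.memℓp a.1).summable h0).tendsto_cofinite_zero
    have h2 := (Real.continuousAt_rpow_const 0 (p.toReal⁻¹)
      (Or.inr (inv_nonneg.2 h0.le))).tendsto.comp h
    rw [Real.zero_rpow (inv_ne_zero h0.ne')] at h2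
    refine tendsto_zero_iff_norm_tendsto_zero.2 (h2.congr fun n => ?_)
    exact Real.rpow_rpow_inv (norm_nonneg _) h0.ne'

theorem IsExpansionSet.summable_mul (hφ : IsExpansionSet φ) {p : ℝ≥0∞} [Fact (1 ≤ p)]
    (a : seqSpace ι p) (x : Ω) : Summable fun n => a.1 n * φ n x := by
  have hp : p ≠ 0 := (zero_lt_one.trans_le (Fact.out : 1 ≤ p)).ne'
  refine Summable.of_norm_bounded ((hφ.summable x).mul_left ‖a.1‖) fun n => ?_
  rw [norm_mul, Real.norm_eq_abs (φ n x)]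
  exact mul_le_mul_of_nonneg_right (lp.norm_apply_le_norm hp a.1 n) (abs_nonneg _)

/-- The linear map `a ↦ ∑ₙ aₙ φₙ`. -/
def IsExpansionSet.seriesMap (hφ : IsExpansionSet φ) (p : ℝ≥0∞) [Fact (1 ≤ p)] :
    seqSpace ι p →ₗ[ℝ] (Ω → ℝ) where
  toFun a := seriesFn φ (fun n => a.1 n)
  map_add' a b := by
    funext x
    simp only [seriesFn, Pi.add_apply]
    rw [← (hφ.summable_mul a x).tsum_add (hφ.summable_mul b x)]
    exact tsum_congr fun n => add_mul (a.1 n) (b.1 n) (φ n x)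
  map_smul' c a := by
    funext x
    simp only [seriesFn, Pi.smul_apply, RingHom.id_apply, smul_eq_mul]
    rw [← tsum_mul_left]
    exact tsum_congr fun n => mul_assoc c (a.1 n) (φ n x)

theorem IsExpansionSet.seriesMap_injective (hφ : IsExpansionSet φ) (p : ℝ≥0∞) [Fact (1 ≤ p)] :
    Function.Injective (hφ.seriesMap p) := fun a b h => by
  have h' := hφ.unique _ _ (seqSpace_tendsto a) (seqSpace_tendsto b) h
  exact Subtype.ext (lp.ext h')

theorem IsExpansionSet.measurable_seriesFn [Countable ι] (hφ : IsExpansionSet φ) {p : ℝ≥0∞}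
    [Fact (1 ≤ p)] (a : seqSpace ι p) : Measurable (seriesFn φ fun n => a.1 n) := by
  refine measurable_of_tendsto_metrizable' (atTop : Filter (Finset ι))
    (f := fun s x => ∑ n ∈ s, a.1 n * φ n x) (fun s => ?_) ?_
  · exact Finset.measurable_fun_sum s fun n _ => (hφ.measurable n).const_mul _
  · exact tendsto_pi_nhds.2 fun x => (hφ.summable_mul a x).hasSum

/-- The normed space of all functions `f = ∑ₙ aₙ φₙ` with `(aₙ) ∈ ℓᵖ` (for `p = ∞`:
`(aₙ) ∈ c₀`), with the norm `‖f‖ = ‖(aₙ)‖ₚ`. -/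
def seriesSpace [Countable ι] (φ : ι → Ω → ℝ) (hφ : IsExpansionSet φ) (p : ℝ≥0∞)
    [Fact (1 ≤ p)] : NormedFunctionSpace Ω where
  toSubmodule := LinearMap.range (hφ.seriesMap p)
  measurable' := by
    rintro _ ⟨a, rfl⟩
    exact hφ.measurable_seriesFn a
  norm' f := ‖(LinearEquiv.ofInjective _ (hφ.seriesMap_injective p)).symm f‖
  norm_nonneg' _ := norm_nonneg _
  norm_smul' c f := by rw [map_smul, norm_smul, Real.norm_eq_abs]
  norm_add_le' f g := by rw [map_add]; exact norm_add_le _ _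
  norm_eq_zero' f hf := by simpa using hf

end SeriesSpace

end

noncomputable section

open scoped InnerProductSpace

/-! ### The feature space of a positive definite kernel -/

section FeatureMap

universe u

/-! Write φₙ = √λₙ eₙ. Everything rests on Mercer's expansion K(x,y) = ∑ φₙ(x) φₙ(y)
(`IsEigenSystem.hasSum_kernel`): K(x,·) is the series with coefficients (φₙ(x)), which by assumption
lie in ℓ¹, hence in every ℓ^q and in c₀. The dual of ℓ^p (of c₀ for p = ∞) is ℓ^q under ∑ aₙ bₙ
(`seqSpace.dualEquiv`), so pairing f = ∑ aₙ φₙ with K(x,·) gives ∑ aₙ φₙ(x) = f(x), and likewise on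
the other side. For p = 1 the dual is all of ℓ^∞, so F consists of the series with bounded
coefficients.

Mercer: let Φ be the feature map of K into its reproducing kernel Hilbert space. The covariance
operator ∫ Φ(y) ⊗ Φ(y) dμ is compact and self-adjoint, and full support makes it injective. The
vectors vₙ = λₙ^(-1/2) ∫ eₙ Φ dμ are orthonormal eigenvectors with ⟨Φ(x), vₙ⟩ = φₙ(x).
Exhaustiveness of the eigensystem leaves no eigenvector orthogonal to all vₙ, so they form a Hilbert
basis and Parseval gives the expansion.

Uniqueness of bounded coefficients (`IsEigenSystem.injective_seriesFn`): ∑ λₙ ≤ ∫ K(x,x) dμ, so a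
vanishing series with bounded coefficients also converges in L²(μ), where orthonormality kills the
coefficients. -/

theorem IsPositiveDefiniteKernel.finsupp_sum_nonneg {Ω : Type*} {K : Ω → Ω → ℝ}
    (hK : IsPositiveDefiniteKernel K) (v : Ω →₀ ℝ) :
    0 ≤ v.sum fun x a => v.sum fun y b => a * b * K x y := by
  have h := hK v.support.card (fun i => (v.support.equivFin.symm i : Ω))
    (Subtype.val_injective.comp v.support.equivFin.symm.injective)
    (fun i => v (v.support.equivFin.symm i : Ω))
  have key (g : Ω → ℝ) :
      ∑ i, g (v.support.equivFin.symm i : Ω) = ∑ x ∈ v.support, g x := by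
    rw [Equiv.sum_comp v.support.equivFin.symm (fun y : v.support => g y)]
    exact Finset.sum_coe_sort v.support g
  simp only [Finsupp.sum]
  rw [← key]
  simp_rw [← key]
  exact h

/-- Moore's theorem for real-valued kernels, with continuity of the feature map. -/
theorem IsPositiveDefiniteKernel.exists_featureMap {Ω : Type u} [TopologicalSpace Ω]
    {K : Ω → Ω → ℝ} (hK : IsPositiveDefiniteKernel K) (hK_symm : ∀ x y, K x y = K y x)
    (hK_cont : Continuous (Function.uncurry K)) :
    ∃ (H : Type u) (_ : NormedAddCommGroup H) (_ : InnerProductSpace ℝ H) (_ : CompleteSpace H)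
      (Φ : Ω → H), Continuous Φ ∧ (∀ x y, ⟪Φ x, Φ y⟫_ℝ = K x y) ∧
        ∀ h, (∀ x, ⟪Φ x, h⟫_ℝ = 0) → h = 0 := by
  -- `RKHS` treats operator-valued kernels; a scalar kernel acts on ℝ by multiplication.
  let M : Matrix Ω Ω (ℝ →L[ℝ] ℝ) := fun x y => K x y • (1 : ℝ →L[ℝ] ℝ)
  have hM : M.PosSemidef := by
    have h := (RKHS.posSemidef_tfae (K := M)).out 0 2
    refine h.mpr ⟨?_, fun v => ?_⟩
    · refine Matrix.IsHermitian.ext fun x y => ?_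
      simp [M, hK_symm x y]
    · refine (hK.finsupp_sum_nonneg v).trans_eq ?_
      simp only [M, RCLike.re_to_real]
      refine Finsupp.sum_congr fun x _ => Finsupp.sum_congr fun y _ => ?_
      simp [hK_symm x y]
      ring
  have : Fact M.PosSemidef := ⟨hM⟩
  have hΦ (x y : Ω) : ⟪RKHS.kerFun (RKHS.OfKernel M) x 1, RKHS.kerFun (RKHS.OfKernel M) y 1⟫_ℝ
      = K x y := by
    rw [← RKHS.kernel_inner, RKHS.OfKernel.kernel_ofKernel]
    simp [M, hK_symm x y]
  refine ⟨RKHS.OfKernel M, inferInstance, inferInstance, inferInstance,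
    fun x => RKHS.kerFun (RKHS.OfKernel M) x 1, ?_, hΦ, fun h hh => ?_⟩
  -- ‖Φ(y) - Φ(x)‖² = K(y,y) - 2K(y,x) + K(x,x), which tends to 0 as y → x.
  · refine continuous_iff_continuousAt.2 fun x => tendsto_iff_norm_sub_tendsto_zero.2 ?_
    have h1 : Continuous fun y => Real.sqrt (K y y - 2 * K y x + K x x) := by
      have h2 : Continuous fun y => K y y := hK_cont.comp (continuous_id.prodMk continuous_id)
      have h3 : Continuous fun y => K y x := hK_cont.comp (continuous_id.prodMk continuous_const)
      fun_prop
    have h4 := h1.tendsto x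
    rw [show K x x - 2 * K x x + K x x = 0 by ring, Real.sqrt_zero] at h4
    refine h4.congr fun y => ?_
    rw [← Real.sqrt_sq (norm_nonneg (_ - _)), norm_sub_sq_real, ← real_inner_self_eq_norm_sq,
      ← real_inner_self_eq_norm_sq, hΦ, hΦ, hΦ]
  · refine RKHS.ext fun x => ?_
    have := hh x
    rw [RKHS.kerFun_inner] at this
    simpa using this

end FeatureMap

/-! ### Mercer's theorem -/

section Mercer

theorem continuous_rankOne_self {Ω H : Type*} [TopologicalSpace Ω]
    [NormedAddCommGroup H] [InnerProductSpace ℝ H] {Φ : Ω → H} (hΦ : Continuous Φ) :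
    Continuous fun y => InnerProductSpace.rankOne ℝ (Φ y) (Φ y) :=
  ((InnerProductSpace.rankOne ℝ : H →L[ℝ] H →L⋆[ℝ] H →L[ℝ] H).continuous.comp hΦ).clm_apply hΦ

variable {Ω : Type*} [TopologicalSpace Ω] [CompactSpace Ω] [MeasurableSpace Ω] [BorelSpace Ω]
  {E : Type*} [NormedAddCommGroup E]

/-- `E` need not be separable: strong measurability comes from compact support. -/
theorem Continuous.integrable_of_compactSpace {f : Ω → E} (hf : Continuous f) (μ : Measure Ω)
    [IsFiniteMeasure μ] : Integrable f μ := by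
  obtain ⟨C, hC⟩ := (isCompact_range hf).isBounded.exists_norm_le
  refine Integrable.of_bound (hf.stronglyMeasurable_of_hasCompactSupport
    (HasCompactSupport.of_compactSpace f)).aestronglyMeasurable C (ae_of_all _ fun x => ?_)
  exact hC _ ⟨x, rfl⟩

theorem integral_mem_of_isClosed [NormedSpace ℝ E] [CompleteSpace E] {S : Submodule ℝ E}
    (hS : IsClosed (S : Set E)) {μ : Measure Ω} [IsFiniteMeasure μ] {f : Ω → E}
    (hf : Continuous f) (hmem : ∀ y, f y ∈ S) : ∫ y, f y ∂μ ∈ S := by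
  have : CompleteSpace S := hS.completeSpace_coe
  have hc : Continuous fun y => (⟨f y, hmem y⟩ : S) := hf.subtype_mk hmem
  have h := S.subtypeL.integral_comp_comm (hc.integrable_of_compactSpace μ)
  have h2 : ∫ y, f y ∂μ = S.subtypeL (∫ y, (⟨f y, hmem y⟩ : S) ∂μ) := h
  rw [h2]
  exact (∫ y, (⟨f y, hmem y⟩ : S) ∂μ).2

variable {H : Type*} [NormedAddCommGroup H] [InnerProductSpace ℝ H]
  {Φ : Ω → H} (μ : Measure Ω) [IsFiniteMeasure μ]

/-- The covariance operator `∫ Φ(y) ⊗ Φ(y) dμ(y)`. -/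
def covarianceOp (Φ : Ω → H) (μ : Measure Ω) : H →L[ℝ] H :=
  ∫ y, InnerProductSpace.rankOne ℝ (Φ y) (Φ y) ∂μ

variable {μ}

theorem covarianceOp_apply (hΦ : Continuous Φ) (h : H) :
    covarianceOp Φ μ h = ∫ y, ⟪Φ y, h⟫_ℝ • Φ y ∂μ := by
  rw [covarianceOp, ContinuousLinearMap.integral_apply
    ((continuous_rankOne_self hΦ).integrable_of_compactSpace μ)]
  simp

variable [CompleteSpace H]

theorem inner_covarianceOp (hΦ : Continuous Φ) (g h : H) :
    ⟪g, covarianceOp Φ μ h⟫_ℝ = ∫ y, ⟪Φ y, h⟫_ℝ * ⟪g, Φ y⟫_ℝ ∂μ := by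
  rw [covarianceOp_apply hΦ, ← integral_inner
    (Continuous.integrable_of_compactSpace (by fun_prop) μ)]
  simp [inner_smul_right]

theorem isSymmetric_covarianceOp (hΦ : Continuous Φ) : (covarianceOp Φ μ).IsSymmetric := by
  intro g h
  simp only [ContinuousLinearMap.coe_coe]
  rw [real_inner_comm, inner_covarianceOp hΦ, inner_covarianceOp hΦ]
  simp [real_inner_comm, mul_comm]

/-- The integrand has rank one, and the compact operators form a closed subspace. -/
theorem isCompactOperator_covarianceOp (hΦ : Continuous Φ) :
    IsCompactOperator (covarianceOp Φ μ) := by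
  refine integral_mem_of_isClosed (S := compactOperator (RingHom.id ℝ) H H)
    isClosed_setOfPred_isCompactOperator (continuous_rankOne_self hΦ) fun y => ?_
  have : IsCompactOperator (innerSL ℝ (Φ y)) :=
    isCompactOperator_of_locallyCompactSpace_dom (innerSL ℝ (Φ y))
  exact this.clm_comp (ContinuousLinearMap.toSpanSingleton ℝ (Φ y))

/-- The quadratic form is ∫ ⟨Φ(y), h⟩² dμ; a continuous integrand that vanishes a.e. vanishes
everywhere by full support. Assuming only `≤ 0` covers zero and negative eigenvalues together. -/
theorem inner_eq_zero_of_inner_covarianceOp_nonpos [μ.IsOpenPosMeasure] (hΦ : Continuous Φ) {h : H}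
    (hh : ⟪h, covarianceOp Φ μ h⟫_ℝ ≤ 0) (x : Ω) : ⟪Φ x, h⟫_ℝ = 0 := by
  rw [inner_covarianceOp hΦ] at hh
  simp only [real_inner_comm _ h] at hh
  have hc : Continuous fun y => ⟪Φ y, h⟫_ℝ * ⟪Φ y, h⟫_ℝ := by fun_prop
  have h0 : ∫ y, ⟪Φ y, h⟫_ℝ * ⟪Φ y, h⟫_ℝ ∂μ = 0 :=
    le_antisymm hh (integral_nonneg fun y => mul_self_nonneg _)
  rw [integral_eq_zero_iff_of_nonneg (fun y => mul_self_nonneg _)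
    (hc.integrable_of_compactSpace μ), hc.ae_eq_iff_eq μ continuous_zero] at h0
  exact mul_self_eq_zero.1 (congrFun h0 x)

variable {ι : Type*} {K : Ω → Ω → ℝ} {l : ι → ℝ} {e : ι → Ω → ℝ}

/-- The eigenfunction `√lₙ eₙ`, as a vector of the feature space. -/
def eigenFeature (Φ : Ω → H) (μ : Measure Ω) (l : ι → ℝ) (e : ι → Ω → ℝ) (n : ι) : H :=
  (Real.sqrt (l n))⁻¹ • ∫ y, e n y • Φ y ∂μ

theorem inner_eigenFeature (hΦ : Continuous Φ) (he : ∀ n, Continuous (e n)) (h : H) (n : ι) :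
    ⟪h, eigenFeature Φ μ l e n⟫_ℝ = (Real.sqrt (l n))⁻¹ * ∫ y, e n y * ⟪h, Φ y⟫_ℝ ∂μ := by
  have hn := he n
  rw [eigenFeature, inner_smul_right, ← integral_inner
    (Continuous.integrable_of_compactSpace (by fun_prop) μ)]
  simp [inner_smul_right]

theorem inner_featureMap_eigenFeature (hΦ : Continuous Φ) (hΦK : ∀ x y, ⟪Φ x, Φ y⟫_ℝ = K x y)
    (h_eigen : IsEigenSystem μ K l e) (x : Ω) (n : ι) :
    ⟪Φ x, eigenFeature Φ μ l e n⟫_ℝ = Real.sqrt (l n) * e n x := by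
  rw [inner_eigenFeature hΦ h_eigen.continuous]
  simp only [hΦK, mul_comm (e n _)]
  have h0 := Real.sqrt_pos.2 (h_eigen.pos n)
  rw [h_eigen.eigen, inv_mul_eq_iff_eq_mul₀ h0.ne', ← mul_assoc,
    Real.mul_self_sqrt (h_eigen.pos n).le]

theorem orthonormal_eigenFeature (hΦ : Continuous Φ) (hΦK : ∀ x y, ⟪Φ x, Φ y⟫_ℝ = K x y)
    (h_eigen : IsEigenSystem μ K l e) : Orthonormal ℝ (eigenFeature Φ μ l e) := by
  classical
  rw [orthonormal_iff_ite]
  intro m n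
  rw [inner_eigenFeature hΦ h_eigen.continuous]
  simp only [real_inner_comm (Φ _), inner_featureMap_eigenFeature hΦ hΦK h_eigen]
  simp only [mul_left_comm (e n _), integral_const_mul]
  split_ifs with h
  · subst h
    have h0 := Real.sqrt_pos.2 (h_eigen.pos m)
    rw [h_eigen.norm_one, mul_one, inv_mul_cancel₀ h0.ne']
  · rw [h_eigen.orthogonal n m (Ne.symm h), mul_zero, mul_zero]

theorem covarianceOp_eigenFeature (hΦ : Continuous Φ) (hΦK : ∀ x y, ⟪Φ x, Φ y⟫_ℝ = K x y)
    (h_eigen : IsEigenSystem μ K l e) (n : ι) :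
    covarianceOp Φ μ (eigenFeature Φ μ l e n) = l n • eigenFeature Φ μ l e n := by
  have h0 := Real.sqrt_pos.2 (h_eigen.pos n)
  rw [covarianceOp_apply hΦ]
  simp only [inner_featureMap_eigenFeature hΦ hΦK h_eigen, mul_smul, integral_smul]
  rw [eigenFeature, smul_smul]
  congr 1
  rw [eq_mul_inv_iff_mul_eq₀ h0.ne', Real.mul_self_sqrt (h_eigen.pos n).le]

/-- The complement is invariant under the covariance operator. The restriction has no eigenvalues,
so being compact and symmetric it is 0; injectivity then leaves only the zero vector. -/
theorem orthogonal_span_eigenFeature [μ.IsOpenPosMeasure] (hΦ : Continuous Φ)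
    (hΦK : ∀ x y, ⟪Φ x, Φ y⟫_ℝ = K x y) (hΦ_total : ∀ h, (∀ x, ⟪Φ x, h⟫_ℝ = 0) → h = 0)
    (h_eigen : IsEigenSystem μ K l e) :
    (Submodule.span ℝ (Set.range (eigenFeature Φ μ l e)))ᗮ = ⊥ := by
  set U := (Submodule.span ℝ (Set.range (eigenFeature Φ μ l e)))ᗮ with hU
  have mem_U (h : H) : h ∈ U ↔ ∀ n, ⟪h, eigenFeature Φ μ l e n⟫_ℝ = 0 := by
    rw [hU, Submodule.mem_orthogonal']
    refine ⟨fun H n => H _ (Submodule.subset_span ⟨n, rfl⟩), fun H v hv => ?_⟩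
    induction hv using Submodule.span_induction with
    | mem v hv => obtain ⟨n, rfl⟩ := hv; exact H n
    | zero => simp
    | add v w _ _ hv hw => rw [inner_add_right, hv, hw, add_zero]
    | smul c v _ hv => rw [inner_smul_right, hv, mul_zero]
  have hinv (h : H) (hh : h ∈ U) : covarianceOp Φ μ h ∈ U := by
    rw [mem_U] at hh ⊢
    intro n
    have := isSymmetric_covarianceOp (μ := μ) hΦ h (eigenFeature Φ μ l e n)
    simp only [ContinuousLinearMap.coe_coe] at this
    rw [this, covarianceOp_eigenFeature hΦ hΦK h_eigen, inner_smul_right, hh n, mul_zero]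
  have hzero (h : H) (hh : ⟪h, covarianceOp Φ μ h⟫_ℝ ≤ 0) : h = 0 :=
    hΦ_total h (inner_eq_zero_of_inner_covarianceOp_nonpos hΦ hh)
  let T : U →L[ℝ] U := (covarianceOp Φ μ).restrict hinv
  have hT_compact : IsCompactOperator T := (isCompactOperator_covarianceOp hΦ).restrict' hinv
  have hT_symm : T.IsSymmetric := (isSymmetric_covarianceOp hΦ).restrict_invariant hinv
  have hT : T = 0 := by
    refine (ContinuousLinearMap.eq_zero_of_forall_hasEigenvalue_eq_zero hT_compact hT_symm).1 ?_
    intro c hc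
    obtain ⟨u, hu, hu0⟩ := hc.exists_hasEigenvector
    exfalso
    rw [Module.End.mem_eigenspace_iff] at hu
    have hu' : covarianceOp Φ μ (u : H) = c • (u : H) := congrArg Subtype.val hu
    refine hu0 (Subtype.ext ?_)
    rcases le_or_gt c 0 with hc0 | hc0
    · refine hzero _ ?_
      rw [hu', inner_smul_right]
      exact mul_nonpos_of_nonpos_of_nonneg hc0 real_inner_self_nonneg
    -- For c > 0, the function y ↦ ⟨Φ(y), u⟩ is a continuous eigenfunction of K orthogonal to every
    -- eₙ, so exhaustiveness makes it 0.
    · refine hΦ_total _ fun x => ?_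
      refine congrFun (h_eigen.exhaustive c (fun y => ⟪Φ y, (u : H)⟫_ℝ) hc0 (by fun_prop)
        (fun y => ?_) fun n => ?_) x
      · have h1 := inner_covarianceOp (μ := μ) hΦ (Φ y) (u : H)
        rw [hu', inner_smul_right] at h1
        rw [h1]
        simp only [hΦK, mul_comm]
      · have h1 := (mem_U u).1 u.2 n
        rw [inner_eigenFeature hΦ h_eigen.continuous, mul_eq_zero] at h1
        have h2 := h1.resolve_left (inv_ne_zero (Real.sqrt_pos.2 (h_eigen.pos n)).ne')
        rw [← h2]
        simp only [real_inner_comm, mul_comm]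
  rw [Submodule.eq_bot_iff]
  intro h hh
  refine hzero h ?_
  have : covarianceOp Φ μ h = 0 := congrArg Subtype.val
    (show T ⟨h, hh⟩ = 0 by rw [hT, zero_apply])
  rw [this, inner_zero_right]

end Mercer

/-- **Mercer's theorem**, with pointwise summation. -/
theorem IsEigenSystem.hasSum_kernel {Ω ι : Type*} [TopologicalSpace Ω] [CompactSpace Ω]
    [MeasurableSpace Ω] [BorelSpace Ω] {μ : Measure Ω} [IsFiniteMeasure μ] [μ.IsOpenPosMeasure]
    {K : Ω → Ω → ℝ} {l : ι → ℝ} {e : ι → Ω → ℝ} (h_eigen : IsEigenSystem μ K l e)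
    (hK_cont : Continuous (Function.uncurry K)) (hK_symm : ∀ x y, K x y = K y x)
    (hK_pos : IsPositiveDefiniteKernel K) (x y : Ω) :
    HasSum (fun n => Real.sqrt (l n) * e n x * (Real.sqrt (l n) * e n y)) (K x y) := by
  obtain ⟨H, _, _, _, Φ, hΦ, hΦK, hΦ_total⟩ := hK_pos.exists_featureMap hK_symm hK_cont
  let b := HilbertBasis.mkOfOrthogonalEqBot (orthonormal_eigenFeature hΦ hΦK h_eigen)
    (orthogonal_span_eigenFeature hΦ hΦK hΦ_total h_eigen)
  have h := b.hasSum_inner_mul_inner (Φ x) (Φ y)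
  rw [hΦK] at h
  refine h.congr_fun fun n => ?_
  simp only [b, HilbertBasis.coe_mkOfOrthogonalEqBot]
  rw [real_inner_comm (Φ y), inner_featureMap_eigenFeature hΦ hΦK h_eigen,
    inner_featureMap_eigenFeature hΦ hΦK h_eigen]

/-! ### Uniqueness of bounded coefficients -/

section Uniqueness

variable {Ω ι : Type*} [TopologicalSpace Ω] [CompactSpace Ω] [MeasurableSpace Ω] [BorelSpace Ω]
  {μ : Measure Ω} [IsFiniteMeasure μ] {K : Ω → Ω → ℝ} {l : ι → ℝ} {e : ι → Ω → ℝ}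

/-- Integrate the diagonal bound ∑ λₙ eₙ(x)² ≤ K(x,x) over finite sets of indices. -/
theorem IsEigenSystem.summable_eigenvalues [μ.IsOpenPosMeasure] (h_eigen : IsEigenSystem μ K l e)
    (hK_cont : Continuous (Function.uncurry K)) (hK_symm : ∀ x y, K x y = K y x)
    (hK_pos : IsPositiveDefiniteKernel K) : Summable l := by
  have hdiag : Continuous fun x => K x x := hK_cont.comp (continuous_id.prodMk continuous_id)
  have hint (n : ι) : Integrable (fun x => l n * (e n x * e n x)) μ :=
    (((h_eigen.continuous n).mul (h_eigen.continuous n)).const_mul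
      (l n)).integrable_of_compactSpace μ
  refine summable_of_sum_le (c := ∫ x, K x x ∂μ) (fun n => (h_eigen.pos n).le) fun s => ?_
  calc ∑ n ∈ s, l n = ∫ x, ∑ n ∈ s, l n * (e n x * e n x) ∂μ := by
        rw [integral_finsetSum _ fun n _ => hint n]
        refine Finset.sum_congr rfl fun n _ => ?_
        rw [integral_const_mul, h_eigen.norm_one, mul_one]
    _ ≤ ∫ x, K x x ∂μ := by
        refine integral_mono (integrable_finsetSum _ fun n _ => hint n)
          (hdiag.integrable_of_compactSpace μ) fun x => ?_
        have h := h_eigen.hasSum_kernel hK_cont hK_symm hK_pos x x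
        refine (Finset.sum_le_sum fun n _ => ?_).trans
          (sum_le_hasSum s (fun n _ => mul_self_nonneg _) h)
        rw [mul_mul_mul_comm, Real.mul_self_sqrt (h_eigen.pos n).le]

/-- A continuous function on a compact space, as an element of `L²(μ)`. -/
def contToL2 (μ : Measure Ω) [IsFiniteMeasure μ] (f : Ω → ℝ) (hf : Continuous f) : Lp ℝ 2 μ :=
  MemLp.toLp f ((memLp_two_iff_integrable_sq
    (hf.integrable_of_compactSpace μ).aestronglyMeasurable).2
      ((hf.pow 2).integrable_of_compactSpace μ))

theorem contToL2_ae_eq {f : Ω → ℝ} (hf : Continuous f) : contToL2 μ f hf =ᵐ[μ] f :=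
  MemLp.coeFn_toLp _

theorem IsEigenSystem.orthonormal_contToL2 (h_eigen : IsEigenSystem μ K l e) :
    Orthonormal ℝ fun n => contToL2 μ (e n) (h_eigen.continuous n) := by
  classical
  rw [orthonormal_iff_ite]
  intro m n
  rw [L2.inner_def]
  have : ∫ x, inner ℝ (contToL2 μ (e m) (h_eigen.continuous m) x)
      (contToL2 μ (e n) (h_eigen.continuous n) x) ∂μ = ∫ x, e n x * e m x ∂μ := by
    refine integral_congr_ae ?_
    filter_upwards [contToL2_ae_eq (μ := μ) (h_eigen.continuous m),
      contToL2_ae_eq (μ := μ) (h_eigen.continuous n)] with x h1 h2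
    rw [h1, h2]
    rfl
  rw [this]
  split_ifs with h
  · rw [h, h_eigen.norm_one]
  · exact h_eigen.orthogonal n m (Ne.symm h)

/-- The series also converges in L²(μ), and its L² limit must agree a.e. with the pointwise sum 0.
Inner products with the eₘ then isolate the coefficients. -/
theorem IsEigenSystem.eq_zero_of_hasSum_zero [Countable ι] (h_eigen : IsEigenSystem μ K l e)
    {d : ι → ℝ} (hd : Summable fun n => d n ^ 2)
    (h0 : ∀ x, HasSum (fun n => d n * e n x) 0) : d = 0 := by
  set E : ι → Lp ℝ 2 μ := fun n => contToL2 μ (e n) (h_eigen.continuous n) with hE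
  have hE_on : Orthonormal ℝ E := h_eigen.orthonormal_contToL2
  have hsum : Summable fun n => d n • E n := by
    have := (hE_on.orthogonalFamily.summable_iff_norm_sq_summable d).2 (by simpa using hd)
    simpa using this
  obtain ⟨g, hg⟩ := hsum
  have hmeas := tendstoInMeasure_of_tendsto_Lp hg
  -- Since `ι` is countable, a.e. convergence can be extracted along a sequence of finite sets that
  -- still tends to `atTop`, so the pointwise sums converge along it too.
  obtain ⟨ns, hns, hns'⟩ := hmeas.exists_seq_tendsto_ae'
  have hpart : ∀ᵐ x ∂μ, ∀ n, E n x = e n x :=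
    ae_all_iff.2 fun n => contToL2_ae_eq (h_eigen.continuous n)
  have hfin : ∀ᵐ x ∂μ, ∀ k, (∑ n ∈ ns k, d n • E n : Lp ℝ 2 μ) x = ∑ n ∈ ns k, d n * E n x := by
    refine ae_all_iff.2 fun k => ?_
    generalize ns k = s
    classical
    induction s using Finset.induction_on with
    | empty =>
      filter_upwards [Lp.coeFn_zero ℝ 2 μ] with x hx
      simpa using hx
    | insert a s ha ih =>
      simp only [Finset.sum_insert ha]
      filter_upwards [ih, Lp.coeFn_add (d a • E a) (∑ n ∈ s, d n • E n),
        Lp.coeFn_smul (d a) (E a)] with x h1 h2 h3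
      rw [h2, Pi.add_apply, h3, h1, Pi.smul_apply, smul_eq_mul]
  have hg0 : g = 0 := by
    refine Lp.ext ?_
    filter_upwards [hns', hpart, hfin, Lp.coeFn_zero ℝ 2 μ] with x h1 h2 h3 h4
    rw [h4, Pi.zero_apply]
    refine tendsto_nhds_unique h1 (((h0 x).comp hns).congr fun k => ?_)
    simp only [Function.comp_apply, h3 k, h2]
  funext m
  have h1 := (innerSL ℝ (E m)).hasSum hg
  rw [hg0, map_zero] at h1
  classical
  have h2 : HasSum (fun n => innerSL ℝ (E m) (d n • E n)) (d m) := by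
    convert! hasSum_ite_eq m (d m) using 2 with n
    rw [innerSL_apply_apply, inner_smul_right, orthonormal_iff_ite.1 hE_on]
    split_ifs with h3 h4 h4
    · simp [h3]
    · exact absurd h3.symm h4
    · exact absurd h4.symm h3
    · simp
  exact h2.unique h1

/-- The functions `√lₙ eₙ` determine even bounded coefficients. -/
theorem IsEigenSystem.injective_seriesFn [Countable ι] [μ.IsOpenPosMeasure]
    (h_eigen : IsEigenSystem μ K l e)
    (hK_cont : Continuous (Function.uncurry K)) (hK_symm : ∀ x y, K x y = K y x)
    (hK_pos : IsPositiveDefiniteKernel K)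
    (h_sum : ∀ x, Summable fun n => Real.sqrt (l n) * |e n x|)
    {a b : ι → ℝ} {C : ℝ} (ha : ∀ n, |a n| ≤ C) (hb : ∀ n, |b n| ≤ C)
    (hab : seriesFn (fun n x => Real.sqrt (l n) * e n x) a
      = seriesFn (fun n x => Real.sqrt (l n) * e n x) b) : a = b := by
  have hs {c : ι → ℝ} (hc : ∀ n, |c n| ≤ C) (x : Ω) :
      Summable fun n => c n * (Real.sqrt (l n) * e n x) := by
    refine Summable.of_norm_bounded ((h_sum x).mul_left C) fun n => ?_
    rw [Real.norm_eq_abs, abs_mul, abs_mul, abs_of_nonneg (Real.sqrt_nonneg _)]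
    exact mul_le_mul_of_nonneg_right (hc n) (by positivity)
  -- As |aₙ - bₙ| ≤ 2C, the terms are dominated by (2C)² λₙ.
  have hd : Summable fun n => ((a n - b n) * Real.sqrt (l n)) ^ 2 := by
    refine Summable.of_nonneg_of_le (fun n => sq_nonneg _) (fun n => ?_)
      ((h_eigen.summable_eigenvalues hK_cont hK_symm hK_pos).mul_left ((2 * C) ^ 2))
    rw [mul_pow, Real.sq_sqrt (h_eigen.pos n).le]
    refine mul_le_mul_of_nonneg_right (sq_le_sq' ?_ ?_) (h_eigen.pos n).le <;>
    · have h1 := abs_le.1 (ha n)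
      have h2 := abs_le.1 (hb n)
      linarith
  have h := h_eigen.eq_zero_of_hasSum_zero hd fun x => by
    have h1 := (hs ha x).hasSum.sub (hs hb x).hasSum
    rw [show ∑' n, a n * (Real.sqrt (l n) * e n x) = ∑' n, b n * (Real.sqrt (l n) * e n x) from
      congrFun hab x, sub_self] at h1
    refine h1.congr_fun fun n => ?_
    ring
  funext n
  have h1 := (mul_eq_zero.1 (congrFun h n)).resolve_right (Real.sqrt_pos.2 (h_eigen.pos n)).ne'
  exact sub_eq_zero.1 h1

end Uniqueness

/-! ### Duality of sequence spaces -/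

section Duality

variable {ι : Type*} {p q : ℝ≥0∞} [Fact (1 ≤ p)] [Fact (1 ≤ q)]

open scoped Classical in
theorem tendsto_single_cofinite {ι : Type*} {p : ℝ≥0∞} (n : ι) (c : ℝ) :
    Tendsto (fun m => lp.single (E := fun _ : ι => ℝ) p n c m) cofinite (𝓝 0) := by
  refine tendsto_const_nhds.congr' ?_
  have h : ∀ᶠ m in cofinite, m ≠ n := (Set.finite_singleton n).compl_mem_cofinite
  filter_upwards [h] with m hm
  exact (lp.single_apply_ne (E := fun _ : ι => ℝ) p n c hm).symm

namespace seqSpace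

open scoped Classical in
/-- The `n`-th unit sequence. -/
def unit (p : ℝ≥0∞) [Fact (1 ≤ p)] (n : ι) : seqSpace ι p :=
  ⟨lp.single p n 1, fun _ => tendsto_single_cofinite n 1⟩

open scoped Classical in
theorem sum_smul_unit_apply (s : Finset ι) (c : ι → ℝ) (m : ι) :
    (∑ n ∈ s, c n • unit p n : seqSpace ι p).1 m = if m ∈ s then c m else 0 := by
  have h : ((∑ n ∈ s, c n • unit p n : seqSpace ι p) : lp (fun _ : ι => ℝ) p)
      = ∑ n ∈ s, c n • lp.single p n 1 := by
    simp [unit]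
  rw [h, lp.coeFn_sum, Finset.sum_apply]
  simp [lp.single_apply, Pi.single_apply]

theorem norm_unit (n : ι) : ‖unit p n‖ = 1 := by
  classical
  have h := lp.norm_single (E := fun _ : ι => ℝ)
    (zero_lt_one.trans_le (Fact.out : 1 ≤ p)) n (1 : ℝ)
  rw [norm_one] at h
  convert! h

/-- For p = ∞ this is where c₀ matters: outside a finite set the entries are below ε/2, so the
truncation error is small in supremum norm. -/
theorem hasSum_smul_unit (a : seqSpace ι p) : HasSum (fun n => a.1 n • unit p n) a := by
  classical
  by_cases hp : p = ∞
  · subst hp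
    refine Metric.tendsto_nhds.2 fun ε hε => ?_
    have hfin : {n | ¬ |a.1 n| < ε / 2}.Finite := by
      have h := Metric.tendsto_nhds.1 (a.2 rfl) (ε / 2) (half_pos hε)
      simpa [Filter.eventually_cofinite] using h
    filter_upwards [eventually_ge_atTop hfin.toFinset] with s hs
    rw [dist_eq_norm, Submodule.coe_norm]
    refine (lp.norm_le_of_forall_le (half_pos hε).le fun n => ?_).trans_lt (half_lt_self hε)
    rw [Submodule.coe_sub, lp.coeFn_sub, Pi.sub_apply, sum_smul_unit_apply, Real.norm_eq_abs]
    split_ifs with hn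
    · simpa using (half_pos hε).le
    · rw [zero_sub, abs_neg]
      by_contra! h
      exact hn (hs (hfin.mem_toFinset.2 (not_lt.2 h.le)))
  · have h := lp.hasSum_single hp a.1
    refine (Topology.IsInducing.subtypeVal.hasSum_iff (g := (seqSpace ι p).subtype) _ _).1 ?_
    refine h.congr_fun fun n => ?_
    have h1 := lp.single_smul (E := fun _ : ι => ℝ) p n (a.1 n) (1 : ℝ)
    rw [smul_eq_mul, mul_one] at h1
    exact h1.symm

/-- Test `L` on the extremal vector of Hölder's inequality on `s`, with the signs of the `L (unit p
n)`. -/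
theorem sum_rpow_le_norm_dual (hp : p ≠ ∞) (hq : q ≠ ∞) [p.HolderConjugate q]
    (L : StrongDual ℝ (seqSpace ι p)) (s : Finset ι) :
    ∑ n ∈ s, ‖L (unit p n)‖ ^ q.toReal ≤ ‖L‖ ^ q.toReal := by
  classical
  have hp0 : 0 < p.toReal := ENNReal.toReal_pos (zero_lt_one.trans_le (Fact.out : 1 ≤ p)).ne' hp
  have hq0 : 0 < q.toReal := ENNReal.toReal_pos (zero_lt_one.trans_le (Fact.out : 1 ≤ q)).ne' hq
  have hpq : p.toReal.HolderConjugate q.toReal := by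
    simpa using ENNReal.HolderTriple.toReal (p := p) (q := q) 1 hp0 hq0
  -- The ℓ^q norm on `s` is attained as a pairing with some `g ≥ 0` in the unit ball of ℓ^p.
  obtain ⟨g, hg, hgs⟩ := (NNReal.isGreatest_Lp s (fun n => ‖L (unit p n)‖₊) hpq.symm).1
  set a : seqSpace ι p := ∑ n ∈ s, (SignType.sign (L (unit p n)) * (g n : ℝ)) • unit p n with ha
  have hLa : L a = ∑ n ∈ s, ‖L (unit p n)‖ * g n := by
    rw [ha, map_sum]
    refine Finset.sum_congr rfl fun n _ => ?_
    rw [map_smul, smul_eq_mul, Real.norm_eq_abs, ← sign_mul_self (L (unit p n))]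
    ring
  have hna : ‖a‖ ≤ 1 := by
    rw [Submodule.coe_norm]
    refine lp.norm_le_of_forall_sum_le hp0 zero_le_one fun t => ?_
    rw [Real.one_rpow]
    have hg' : ∑ n ∈ s, (g n : ℝ) ^ p.toReal ≤ 1 := by exact_mod_cast hg
    refine le_trans ?_ hg'
    calc ∑ n ∈ t, ‖a.1 n‖ ^ p.toReal
        ≤ ∑ n ∈ t, if n ∈ s then (g n : ℝ) ^ p.toReal else 0 := by
          refine Finset.sum_le_sum fun n _ => ?_
          rw [ha, sum_smul_unit_apply]
          split_ifs with h
          · refine Real.rpow_le_rpow (norm_nonneg _) ?_ hp0.le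
            rw [norm_mul, Real.norm_of_nonneg (r := (g n : ℝ)) (g n).2]
            refine mul_le_of_le_one_left (g n).2 ?_
            rcases SignType.trichotomy (SignType.sign (L (unit p n))) with h | h | h <;>
              simp [h]
          · simp [Real.zero_rpow hp0.ne']
      _ = ∑ n ∈ t ∩ s, (g n : ℝ) ^ p.toReal := by
          rw [Finset.sum_ite_mem]
      _ ≤ ∑ n ∈ s, (g n : ℝ) ^ p.toReal :=
          Finset.sum_le_sum_of_subset_of_nonneg Finset.inter_subset_right
            fun n _ _ => Real.rpow_nonneg (g n).2 _
  have hgs' : ∑ n ∈ s, ‖L (unit p n)‖ * g n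
      = (∑ n ∈ s, ‖L (unit p n)‖ ^ q.toReal) ^ (1 / q.toReal) := by
    have := congrArg NNReal.toReal hgs
    push_cast at this
    simpa using this
  have hle : (∑ n ∈ s, ‖L (unit p n)‖ ^ q.toReal) ^ (1 / q.toReal) ≤ ‖L‖ := by
    rw [← hgs', ← hLa]
    refine (le_abs_self _).trans ((L.le_opNorm a).trans ?_)
    exact mul_le_of_le_one_right L.opNorm_nonneg hna
  have h0 : 0 ≤ ∑ n ∈ s, ‖L (unit p n)‖ ^ q.toReal :=
    Finset.sum_nonneg fun n _ => Real.rpow_nonneg (norm_nonneg _) _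
  have := Real.rpow_le_rpow (Real.rpow_nonneg h0 _) hle hq0.le
  rwa [← Real.rpow_mul h0, one_div, inv_mul_cancel₀ hq0.ne', Real.rpow_one] at this

/-- Test `L` on the sign vector supported on `s`, which has finite support and so lies in c₀. -/
theorem sum_norm_le_norm_dual (L : StrongDual ℝ (seqSpace ι ∞)) (s : Finset ι) :
    ∑ n ∈ s, ‖L (unit ∞ n)‖ ≤ ‖L‖ := by
  classical
  set a : seqSpace ι ∞ := ∑ n ∈ s, (SignType.sign (L (unit ∞ n)) : ℝ) • unit ∞ n with ha
  have hLa : L a = ∑ n ∈ s, ‖L (unit ∞ n)‖ := by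
    rw [ha, map_sum]
    refine Finset.sum_congr rfl fun n _ => ?_
    rw [map_smul, smul_eq_mul, Real.norm_eq_abs, sign_mul_self]
  have hna : ‖a‖ ≤ 1 := by
    rw [Submodule.coe_norm]
    refine lp.norm_le_of_forall_le zero_le_one fun n => ?_
    rw [ha, sum_smul_unit_apply]
    split_ifs with h
    · rcases SignType.trichotomy (SignType.sign (L (unit ∞ n))) with h | h | h <;> simp [h]
    · simp
  rw [← hLa]
  refine (le_abs_self _).trans ((L.le_opNorm a).trans ?_)
  exact mul_le_of_le_one_right L.opNorm_nonneg hna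

theorem exists_coeff_dual [p.HolderConjugate q] (L : StrongDual ℝ (seqSpace ι p)) :
    ∃ b : lp (fun _ : ι => ℝ) q, (∀ n, b n = L (unit p n)) ∧ ‖b‖ ≤ ‖L‖ := by
  by_cases hq : q = ∞
  · subst hq
    have h (n : ι) : ‖L (unit p n)‖ ≤ ‖L‖ := by
      have h := L.le_opNorm (unit p n)
      rwa [norm_unit, mul_one] at h
    refine ⟨⟨fun n => L (unit p n), memℓp_infty ⟨‖L‖, ?_⟩⟩, fun n => rfl, ?_⟩
    · rintro _ ⟨n, rfl⟩
      exact h n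
    · exact lp.norm_le_of_forall_le L.opNorm_nonneg h
  have hq0 : 0 < q.toReal := ENNReal.toReal_pos (zero_lt_one.trans_le (Fact.out : 1 ≤ q)).ne' hq
  have h (s : Finset ι) : ∑ n ∈ s, ‖L (unit p n)‖ ^ q.toReal ≤ ‖L‖ ^ q.toReal := by
    by_cases hp : p = ∞
    · subst hp
      have hq1 : q = 1 := ENNReal.HolderConjugate.unique ∞ q 1
      subst hq1
      simpa using sum_norm_le_norm_dual L s
    · exact sum_rpow_le_norm_dual hp hq L s
  exact ⟨⟨fun n => L (unit p n), memℓp_gen' h⟩, fun n => rfl,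
    lp.norm_le_of_forall_sum_le hq0 L.opNorm_nonneg h⟩

/-- The pairing `(b, a) ↦ ∑ₙ bₙ aₙ` of `ℓ^q` with `ℓ^p` (or `c₀`). -/
def toDual (p q : ℝ≥0∞) [Fact (1 ≤ p)] [Fact (1 ≤ q)] [q.HolderConjugate p] :
    lp (fun _ : ι => ℝ) q →ₗ[ℝ] StrongDual ℝ (seqSpace ι p) where
  toFun b := (lp.dualPairing q p (fun _ => ContinuousLinearMap.mul ℝ ℝ) (K := 1)
    (fun _ => by simp) b).comp (seqSpace ι p).subtypeL
  map_add' b c := by rw [map_add]; rfl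
  map_smul' r b := by rw [map_smul]; rfl

theorem toDual_apply [q.HolderConjugate p] (b : lp (fun _ : ι => ℝ) q) (a : seqSpace ι p) :
    toDual p q b a = ∑' n, b n * a.1 n := rfl

theorem norm_toDual_le [q.HolderConjugate p] (b : lp (fun _ : ι => ℝ) q) :
    ‖toDual p q b‖ ≤ ‖b‖ := by
  refine ContinuousLinearMap.opNorm_le_bound _ (norm_nonneg b) fun a => ?_
  have h := ContinuousLinearMap.le_of_opNorm_le _ (lp.norm_dualPairing (p := q) (q := p)
    (fun _ : ι => ContinuousLinearMap.mul ℝ ℝ) (K := 1) (fun _ => by simp)) b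
  rw [NNReal.coe_one, one_mul] at h
  exact ContinuousLinearMap.le_of_opNorm_le _ h a.1

theorem toDual_unit [q.HolderConjugate p] (b : lp (fun _ : ι => ℝ) q) (n : ι) :
    toDual p q b (unit p n) = b n := by
  classical
  rw [toDual_apply, tsum_eq_single n]
  · simp [unit]
  · intro m hm
    simp [unit, hm]

/-- The unit sequences span a dense subspace, by `hasSum_smul_unit`. -/
theorem ext_dual {L M : StrongDual ℝ (seqSpace ι p)} (h : ∀ n, L (unit p n) = M (unit p n)) :
    L = M := by
  ext a
  refine (L.hasSum (hasSum_smul_unit a)).unique ?_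
  simpa [h] using M.hasSum (hasSum_smul_unit a)

/-- The dual of `ℓ^p` (for `p = ∞`: of `c₀`) is `ℓ^q`. -/
def dualEquiv (p q : ℝ≥0∞) [Fact (1 ≤ p)] [Fact (1 ≤ q)] [p.HolderConjugate q]
    [q.HolderConjugate p] : lp (fun _ : ι => ℝ) q ≃ₗᵢ[ℝ] StrongDual ℝ (seqSpace ι p) where
  toLinearEquiv := LinearEquiv.ofBijective (toDual p q) (by
    refine ⟨fun b c h => ?_, fun L => ?_⟩
    · refine lp.ext (funext fun n => ?_)
      rw [← toDual_unit (p := p) b n, h, toDual_unit]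
    · obtain ⟨b, hb, -⟩ := exists_coeff_dual (q := q) L
      exact ⟨b, ext_dual fun n => by rw [toDual_unit, hb]⟩)
  norm_map' b := by
    refine le_antisymm (norm_toDual_le b) ?_
    -- The coefficients recovered from the functional of `b` are `b` itself, and their norm is at
    -- most that of the functional.
    obtain ⟨c, hc, hcn⟩ := exists_coeff_dual (q := q) (toDual p q b)
    have : c = b := lp.ext (funext fun n => by rw [hc, toDual_unit])
    rw [this] at hcn
    exact hcn

theorem dualEquiv_apply [p.HolderConjugate q] [q.HolderConjugate p]
    (b : lp (fun _ : ι => ℝ) q) (a : seqSpace ι p) :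
    dualEquiv p q b a = ∑' n, b n * a.1 n := rfl

theorem isClosed (ι : Type*) (p : ℝ≥0∞) [Fact (1 ≤ p)] :
    IsClosed (seqSpace ι p : Set (lp (fun _ : ι => ℝ) p)) := by
  by_cases hp : p = ∞
  · subst hp
    refine isClosed_of_closure_subset fun a ha _ => ?_
    refine Metric.tendsto_nhds.2 fun ε hε => ?_
    obtain ⟨b, hb, hab⟩ := Metric.mem_closure_iff.1 ha (ε / 2) (half_pos hε)
    filter_upwards [Metric.tendsto_nhds.1 (hb rfl) (ε / 2) (half_pos hε)] with n hn
    have h := lp.norm_apply_le_norm (by simp) (a - b) n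
    rw [dist_eq_norm] at hab
    rw [lp.coeFn_sub, Pi.sub_apply] at h
    rw [dist_zero_right] at hn ⊢
    have := norm_sub_norm_le (a n) (b n)
    linarith
  · have : seqSpace ι p = ⊤ := eq_top_iff.2 fun a _ h => absurd h hp
    rw [this]
    exact isClosed_univ

instance : CompleteSpace (seqSpace ι p) := (isClosed ι p).completeSpace_coe

end seqSpace

end Duality

/-! ### Function spaces parametrized by sequences -/

section Parametrization

variable {Ω : Type*} [MeasurableSpace Ω] {X : Type*} [NormedAddCommGroup X] [NormedSpace ℝ X]

/-- The range of an injective linear map into the measurable functions, with the norm of the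
domain. -/
def NormedFunctionSpace.ofInjective (T : X →ₗ[ℝ] (Ω → ℝ)) (hT : Function.Injective T)
    (hmeas : ∀ a, Measurable (T a)) : NormedFunctionSpace Ω where
  toSubmodule := LinearMap.range T
  measurable' := by
    rintro _ ⟨a, rfl⟩
    exact hmeas a
  norm' f := ‖(LinearEquiv.ofInjective T hT).symm f‖
  norm_nonneg' _ := norm_nonneg _
  norm_smul' c f := by rw [map_smul, norm_smul, Real.norm_eq_abs]
  norm_add_le' f g := by rw [map_add]; exact norm_add_le _ _
  norm_eq_zero' f hf := by simpa using hf

namespace NormedFunctionSpace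

variable (T : X →ₗ[ℝ] (Ω → ℝ)) (hT : Function.Injective T) (hmeas : ∀ a, Measurable (T a))

/-- The parametrization of `ofInjective T`. -/
def ofInjectiveEquiv : X ≃ₗᵢ[ℝ] (ofInjective T hT hmeas).Elem where
  toLinearEquiv := LinearEquiv.ofInjective T hT
  norm_map' a := congrArg norm ((LinearEquiv.ofInjective T hT).symm_apply_apply a)

theorem Elem.fn_injective {B : NormedFunctionSpace Ω} : Function.Injective (Elem.fn (B := B)) :=
  Subtype.val_injective

theorem Elem.fn_mem {B : NormedFunctionSpace Ω} (f : B.Elem) : f.fn ∈ B.toSubmodule := f.2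

end NormedFunctionSpace

end Parametrization

/-- Isometrically isomorphic spaces have isometrically isomorphic duals. -/
def LinearIsometryEquiv.dualCongr {X Y : Type*} [NormedAddCommGroup X] [NormedSpace ℝ X]
    [NormedAddCommGroup Y] [NormedSpace ℝ Y] (e : X ≃ₗᵢ[ℝ] Y) :
    StrongDual ℝ X ≃ₗᵢ[ℝ] StrongDual ℝ Y where
  toFun L := L.comp (e.symm.toContinuousLinearEquiv : Y →L[ℝ] X)
  invFun M := M.comp (e.toContinuousLinearEquiv : X →L[ℝ] Y)
  map_add' _ _ := rfl
  map_smul' _ _ := rfl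
  left_inv L := by ext x; simp
  right_inv M := by ext y; simp
  norm_map' L := ContinuousLinearMap.opNorm_comp_linearIsometryEquiv L e.symm

/-! ### Duals of the spaces of series and the reproducing property -/

section Series

open NormedFunctionSpace

variable {Ω ι : Type*} [MeasurableSpace Ω] {φ : ι → Ω → ℝ}

/-- The coefficients of `K(x,·)`. -/
def kernelCoeff (hφ : IsExpansionSet φ) (q : ℝ≥0∞) [Fact (1 ≤ q)] (x : Ω) :
    lp (fun _ : ι => ℝ) q :=
  -- The sequence is in ℓ¹, hence in ℓ^q for every q ≥ 1.
  ⟨fun n => φ n x, Memℓp.of_exponent_ge (q := 1)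
    (memℓp_gen (by simpa using hφ.summable x)) Fact.out⟩

theorem tendsto_kernelCoeff (hφ : IsExpansionSet φ) (x : Ω) :
    Tendsto (fun n => φ n x) cofinite (𝓝 0) :=
  (hφ.summable x).of_abs.tendsto_cofinite_zero

theorem IsExpansionSet.summable_bounded_mul (hφ : IsExpansionSet φ)
    (a : lp (fun _ : ι => ℝ) ∞) (x : Ω) : Summable fun n => a n * φ n x := by
  refine Summable.of_norm_bounded ((hφ.summable x).mul_left ‖a‖) fun n => ?_
  rw [norm_mul, Real.norm_eq_abs (φ n x)]
  exact mul_le_mul_of_nonneg_right (lp.norm_apply_le_norm (by simp) a n) (abs_nonneg _)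

/-- The linear map `a ↦ ∑ₙ aₙ φₙ` on the bounded sequences. -/
def IsExpansionSet.boundedSeriesMap (hφ : IsExpansionSet φ) :
    lp (fun _ : ι => ℝ) ∞ →ₗ[ℝ] (Ω → ℝ) where
  toFun a := seriesFn φ fun n => a n
  map_add' a b := by
    funext x
    simp only [seriesFn, Pi.add_apply]
    rw [← (hφ.summable_bounded_mul a x).tsum_add (hφ.summable_bounded_mul b x)]
    exact tsum_congr fun n => add_mul (a n) (b n) (φ n x)
  map_smul' c a := by
    funext x
    simp only [seriesFn, Pi.smul_apply, RingHom.id_apply, smul_eq_mul]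
    rw [← tsum_mul_left]
    exact tsum_congr fun n => mul_assoc c (a n) (φ n x)

variable [Countable ι]

/-- The parametrization of the space of series by its coefficients. -/
def seriesEquiv (hφ : IsExpansionSet φ) (p : ℝ≥0∞) [Fact (1 ≤ p)] :
    seqSpace ι p ≃ₗᵢ[ℝ] (seriesSpace φ hφ p).Elem :=
  -- `seriesSpace` agrees by definition with `ofInjective` applied to `seriesMap`.
  ofInjectiveEquiv (hφ.seriesMap p) (hφ.seriesMap_injective p) hφ.measurable_seriesFn

theorem fn_seriesEquiv (hφ : IsExpansionSet φ) (p : ℝ≥0∞) [Fact (1 ≤ p)] (a : seqSpace ι p) :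
    (seriesEquiv hφ p a).fn = seriesFn φ (fun n => a.1 n) := rfl

theorem completeSpace_seriesSpace (hφ : IsExpansionSet φ) (p : ℝ≥0∞) [Fact (1 ≤ p)] :
    CompleteSpace (seriesSpace φ hφ p).Elem :=
  (completeSpace_congr (e := (seriesEquiv hφ p).toEquiv)
    (seriesEquiv hφ p).isometry.isUniformEmbedding).1 inferInstance

variable {p q : ℝ≥0∞} [Fact (1 ≤ p)] [Fact (1 ≤ q)] [p.HolderConjugate q] [q.HolderConjugate p]

/-- The identification of the dual of a space of series with a function space `F` parametrized by
`ℓ^q`. -/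
def seriesDualEquiv (hφ : IsExpansionSet φ) {F : NormedFunctionSpace Ω}
    (Ψ : lp (fun _ : ι => ℝ) q ≃ₗᵢ[ℝ] F.Elem) :
    StrongDual ℝ (seriesSpace φ hφ p).Elem ≃ₗᵢ[ℝ] F.Elem :=
  ((seriesEquiv hφ p).symm.dualCongr.trans (seqSpace.dualEquiv p q).symm).trans Ψ

theorem seriesDualEquiv_symm_apply (hφ : IsExpansionSet φ) {F : NormedFunctionSpace Ω}
    (Ψ : lp (fun _ : ι => ℝ) q ≃ₗᵢ[ℝ] F.Elem) (b : lp (fun _ : ι => ℝ) q) (a : seqSpace ι p) :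
    (seriesDualEquiv hφ Ψ).symm (Ψ b) (seriesEquiv hφ p a) = ∑' n, b n * a.1 n := by
  have h : (seriesDualEquiv (p := p) hφ Ψ).symm (Ψ b) =
      (seriesEquiv hφ p).dualCongr (seqSpace.dualEquiv p q b) := by
    rw [LinearIsometryEquiv.symm_apply_eq]
    refine congrArg Ψ ((seqSpace.dualEquiv p q).symm_apply_eq.2 ?_).symm
    ext a
    exact congrArg (seqSpace.dualEquiv p q b) ((seriesEquiv hφ p).symm_apply_apply a)
  rw [h, ← seqSpace.dualEquiv_apply]
  exact congrArg (seqSpace.dualEquiv p q b) ((seriesEquiv hφ p).symm_apply_apply a)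

variable {K : Ω → Ω → ℝ}

/-- K(x,·) has the coefficients φₙ(x), so its pairing with ∑ aₙ φₙ is the value of that series at x.
`F` is left abstract to cover both ℓ^q with q < ∞ and the full ℓ^∞. -/
theorem seriesDualEquiv_right (hφ : IsExpansionSet φ)
    (hK : ∀ x y, HasSum (fun n => φ n x * φ n y) (K x y)) {F : NormedFunctionSpace Ω}
    (Ψ : lp (fun _ : ι => ℝ) q ≃ₗᵢ[ℝ] F.Elem) (hΨ : ∀ b, (Ψ b).fn = seriesFn φ fun n => b n)
    (x : Ω) : ∃ hx : K x ∈ F.toSubmodule, ∀ f : (seriesSpace φ hφ p).Elem,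
      (seriesDualEquiv hφ Ψ).symm (F.elem (K x) hx) f = f.fn x := by
  have h : (Ψ (kernelCoeff hφ q x)).fn = K x := by
    rw [hΨ]
    exact funext fun y => (hK x y).tsum_eq
  have hx : K x ∈ F.toSubmodule := h ▸ (Ψ (kernelCoeff hφ q x)).fn_mem
  refine ⟨hx, fun f => ?_⟩
  obtain ⟨a, rfl⟩ := (seriesEquiv hφ p).surjective f
  have h2 : F.elem (K x) hx = Ψ (kernelCoeff hφ q x) := Elem.fn_injective h.symm
  rw [h2, seriesDualEquiv_symm_apply, fn_seriesEquiv]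
  exact tsum_congr fun n => mul_comm _ _

theorem seriesDualEquiv_left (hφ : IsExpansionSet φ)
    (hK : ∀ x y, HasSum (fun n => φ n x * φ n y) (K x y)) {F : NormedFunctionSpace Ω}
    (Ψ : lp (fun _ : ι => ℝ) q ≃ₗᵢ[ℝ] F.Elem) (hΨ : ∀ b, (Ψ b).fn = seriesFn φ fun n => b n)
    (y : Ω) : ∃ hy : (fun x => K x y) ∈ (seriesSpace φ hφ p).toSubmodule, ∀ g : F.Elem,
      (seriesDualEquiv hφ Ψ).symm g ((seriesSpace φ hφ p).elem (fun x => K x y) hy) = g.fn y := by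
  let k : seqSpace ι p := ⟨kernelCoeff hφ p y, fun _ => tendsto_kernelCoeff hφ y⟩
  have h : (seriesEquiv hφ p k).fn = fun x => K x y := by
    rw [fn_seriesEquiv]
    funext x
    rw [← (hK x y).tsum_eq]
    exact tsum_congr fun n => mul_comm _ _
  have hy : (fun x => K x y) ∈ (seriesSpace φ hφ p).toSubmodule :=
    h ▸ (seriesEquiv hφ p k).fn_mem
  refine ⟨hy, fun g => ?_⟩
  obtain ⟨b, rfl⟩ := Ψ.surjective g
  have h2 : (seriesSpace φ hφ p).elem (fun x => K x y) hy = seriesEquiv hφ p k :=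
    Elem.fn_injective h.symm
  rw [h2, seriesDualEquiv_symm_apply, hΨ]
  rfl

/-- Continuity of K would not suffice: without second countability the Borel sets of Ω × Ω may
exceed the product σ-algebra. The countable expansion stays within the latter. -/
theorem measurable_of_hasSum (hφ : IsExpansionSet φ)
    (hK : ∀ x y, HasSum (fun n => φ n x * φ n y) (K x y)) : Measurable (Function.uncurry K) := by
  refine measurable_of_tendsto_metrizable' (atTop : Filter (Finset ι))
    (f := fun s (z : Ω × Ω) => ∑ n ∈ s, φ n z.1 * φ n z.2) (fun s => ?_)
    (tendsto_pi_nhds.2 fun z => hK z.1 z.2)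
  exact Finset.measurable_fun_sum s fun n _ =>
    ((hφ.measurable n).comp measurable_fst).mul ((hφ.measurable n).comp measurable_snd)

theorem isTwoSidedRKBS_seriesSpace (hφ : IsExpansionSet φ)
    (hK : ∀ x y, HasSum (fun n => φ n x * φ n y) (K x y)) (hq : q ≠ ∞) :
    IsTwoSidedRKBS (seriesSpace φ hφ p) (seriesSpace φ hφ q) K := by
  -- For q < ∞ the sequence space is the whole of ℓ^q, hence the full dual.
  have htop : seqSpace ι q = ⊤ := eq_top_iff.2 fun a _ h => absurd h hq
  let Ψ : lp (fun _ : ι => ℝ) q ≃ₗᵢ[ℝ] (seriesSpace φ hφ q).Elem :=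
    (LinearIsometryEquiv.ofTop _ (seqSpace ι q) htop).symm.trans (seriesEquiv hφ q)
  have hΨ (b : lp (fun _ : ι => ℝ) q) : (Ψ b).fn = seriesFn φ fun n => b n := rfl
  exact ⟨completeSpace_seriesSpace hφ p, measurable_of_hasSum hφ hK, seriesDualEquiv hφ Ψ,
    seriesDualEquiv_right hφ hK Ψ hΨ, seriesDualEquiv_left hφ hK Ψ hΨ⟩

theorem IsExpansionSet.measurable_boundedSeriesMap (hφ : IsExpansionSet φ)
    (a : lp (fun _ : ι => ℝ) ∞) : Measurable (hφ.boundedSeriesMap a) :=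
  measurable_of_tendsto_metrizable' (atTop : Filter (Finset ι))
    (f := fun s x => ∑ n ∈ s, a n * φ n x)
    (fun s => Finset.measurable_fun_sum s fun n _ => (hφ.measurable n).const_mul _)
    (tendsto_pi_nhds.2 fun x => (hφ.summable_bounded_mul a x).hasSum)

theorem exists_isRightSidedRKBS_seriesSpace (hφ : IsExpansionSet φ)
    (hK : ∀ x y, HasSum (fun n => φ n x * φ n y) (K x y))
    (hinj : Function.Injective hφ.boundedSeriesMap) :
    ∃ F : NormedFunctionSpace Ω, (seriesSpace φ hφ ∞).IsIsometricSubspace F ∧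
      IsRightSidedRKBS (seriesSpace φ hφ 1) F K := by
  let Ψ := ofInjectiveEquiv hφ.boundedSeriesMap hinj hφ.measurable_boundedSeriesMap
  refine ⟨ofInjective hφ.boundedSeriesMap hinj hφ.measurable_boundedSeriesMap, ?_,
    completeSpace_seriesSpace hφ 1, measurable_of_hasSum hφ hK, seriesDualEquiv hφ Ψ,
    seriesDualEquiv_right hφ hK Ψ fun b => rfl⟩
  rintro _ ⟨a, rfl⟩
  -- Both norms are the supremum norm of the same coefficients.
  exact ⟨⟨a.1, rfl⟩, (Ψ.norm_map a.1).trans ((seriesEquiv hφ ∞).norm_map a).symm⟩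

end Series

end

theorem mainTheorem9 {Ω : Type*} [TopologicalSpace Ω] [CompactSpace Ω] [T2Space Ω]
    [MeasurableSpace Ω] [BorelSpace Ω] (μ : Measure Ω) [IsFiniteMeasure μ] [μ.IsOpenPosMeasure]
    {ι : Type*} [Countable ι] (K : Ω → Ω → ℝ)
    (hK_cont : Continuous (Function.uncurry K)) (hK_symm : ∀ x y, K x y = K y x)
    (hK_pos : IsPositiveDefiniteKernel K)
    (l : ι → ℝ) (e : ι → Ω → ℝ) (h_eigen : IsEigenSystem μ K l e)
    (h_sum : ∀ x, Summable fun n => Real.sqrt (l n) * |e n x|) :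
    ∃ hφ : IsExpansionSet (fun n x => Real.sqrt (l n) * e n x),
      (∃ F : NormedFunctionSpace Ω,
        (seriesSpace _ hφ ∞).IsIsometricSubspace F ∧
        IsRightSidedRKBS (seriesSpace _ hφ 1) F K) ∧
      ∀ (p q : ℝ≥0∞) [Fact (1 ≤ p)] [Fact (1 ≤ q)], 1 < p → p.HolderConjugate q →
        IsTwoSidedRKBS (seriesSpace _ hφ p) (seriesSpace _ hφ q) K := by
  have hK := h_eigen.hasSum_kernel hK_cont hK_symm hK_pos
  have huniq {a b : ι → ℝ} (ha : BddAbove (Set.range fun n => |a n|))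
      (hb : BddAbove (Set.range fun n => |b n|))
      (hab : seriesFn (fun n x => Real.sqrt (l n) * e n x) a
        = seriesFn (fun n x => Real.sqrt (l n) * e n x) b) : a = b := by
    obtain ⟨A, hA⟩ := ha
    obtain ⟨B, hB⟩ := hb
    exact h_eigen.injective_seriesFn hK_cont hK_symm hK_pos h_sum
      (fun n => (hA ⟨n, rfl⟩).trans (le_max_left A B))
      (fun n => (hB ⟨n, rfl⟩).trans (le_max_right A B)) hab
  have hbdd {a : ι → ℝ} (ha : Tendsto a cofinite (𝓝 0)) :
      BddAbove (Set.range fun n => |a n|) := by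
    have h := ha.abs.isBoundedUnder_le
    exact h.bddAbove_range_of_cofinite
  have hφ : IsExpansionSet (fun n x => Real.sqrt (l n) * e n x) :=
    { measurable := fun n => (h_eigen.continuous n).measurable.const_mul _
      summable := fun x => by simpa [abs_mul, abs_of_nonneg (Real.sqrt_nonneg _)] using h_sum x
      unique := fun a b ha hb => huniq (hbdd ha) (hbdd hb) }
  refine ⟨hφ, exists_isRightSidedRKBS_seriesSpace hφ hK fun a b hab => ?_, ?_⟩
  · exact lp.ext (huniq (memℓp_infty_iff.1 (lp.memℓp a)) (memℓp_infty_iff.1 (lp.memℓp b)) hab)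
  · intro p q _ _ hp hpq
    have : q.HolderConjugate p := hpq.symm
    refine isTwoSidedRKBS_seriesSpace hφ hK ?_
    -- q = ∞ would force p = 1.
    rintro rfl
    exact hp.ne (ENNReal.HolderConjugate.unique ∞ 1 p)
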